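/- Let $G$ be a group and let $Y\subseteq G$ be a finite set with at least two elements such that every element of $G$ is a (non-empty) product of elements of $Y$. Assume that the abelianization $G/[G,G]$ has rank $n\ge 1$, and let $F:Y\to\mathbb R$ satisfy $F(s)>0$ for all $s\in Y$. Choose $n$ linearly independent elements $c'_1,\dots,c'_n$ of the real vector space $\mathrm{Hom}(G,\mathbb R)$ and set $c_s=(c'_1(s),\dots,c'_n(s))\in\mathbb R^n$ for $s\in Y$. For $\beta\in\mathbb R$ put $$Q(\beta)=\Big\{u\in\mathbb R^n:\ \sum_{s\in Y}e^{u\cdot c_s-\beta F(s)}=1\Big\},\qquad N_\beta=\Big\{\big(e^{-\beta F(s)}e^{u\cdot c_s}\big)_{s\in Y}:\ u\in Q(\beta)\Big\},$$ and let $$N_\infty=\bigcap_{b\in\mathbb R}\ \overline{\bigcup_{\beta\ge b}N_\beta}\ \subseteq\ \mathbb R^Y$$ be the limit set of $N_\beta$ as $\beta\to\infty$. Then $N_\infty$ is contained in the simplex $\Delta_Y=\{p\in[0,1]^Y:\ \sum_{s\in Y}p_s=1\}$, and $N_\infty$, with the subspace topology, is homeomorphic to the $(n-1)$-sphere $S^{n-1}=\{v\in\mathbb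 R^n:\ \|v\|=1\}$. -/

import Mathlib

noncomputable section

namespace CayleyKMS

variable {G : Type*} [Group G] {n : ℕ}

/-- The vector `c_s = (c'_1(s), …, c'_n(s)) ∈ ℝⁿ` attached to a group element `s` and a tuple of
homomorphisms `c'_1, …, c'_n : G → ℝ`. -/
def cVec (c' : Fin n → (Additive G →+ ℝ)) (s : G) : EuclideanSpace ℝ (Fin n) :=
  WithLp.toLp 2 fun i => c' i (Additive.ofMul s)

/-- `Q(β) = {u ∈ ℝⁿ : ∑_{s ∈ Y} exp (u · c_s - β F(s)) = 1}`. -/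
def Q (Y : Finset G) (F : Y → ℝ) (c' : Fin n → (Additive G →+ ℝ)) (β : ℝ) :
    Set (EuclideanSpace ℝ (Fin n)) :=
  {u | ∑ s : Y, Real.exp (inner ℝ u (cVec c' (s : G)) - β * F s) = 1}

/-- `N_β = {(e^{-β F(s)} e^{u · c_s})_{s ∈ Y} : u ∈ Q(β)}`, a set of probability vectors on `Y`
(empty when `Q(β)` is). -/
def NBeta (Y : Finset G) (F : Y → ℝ) (c' : Fin n → (Additive G →+ ℝ)) (β : ℝ) :
    Set (Y → ℝ) :=
  (fun u : EuclideanSpace ℝ (Fin n) => fun s : Y =>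
    Real.exp (-β * F s) * Real.exp (inner ℝ u (cVec c' (s : G)))) '' Q Y F c' β

/-- The limit set `N_∞ = ⋂_b closure (⋃_{β ≥ b} N_β)` of `N_β` as `β → ∞`. -/
def NInfty (Y : Finset G) (F : Y → ℝ) (c' : Fin n → (Additive G →+ ℝ)) : Set (Y → ℝ) :=
  ⋂ b : ℝ, closure (⋃ β ∈ Set.Ici b, NBeta Y F c' β)

end CayleyKMS

end

/-! The homeomorphism onto the sphere is the normalised barycentre `p ↦ m(p)/‖m(p)‖`, with `m(p) = ∑
p_s c_s`; since the limit set is compact, a continuous bijection suffices.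

A limit point `p` carries two vectors (`exists_exponent_of_mem_gibbsLimit`): `w` with `w · c_s ≤
F(s)`, equality exactly on the support of `p`, and `v` with `log p_s = v · c_s` on that support.
Pairing `m(p)` with `w` gives `∑ p_s F(s) > 0`, so `m(p) ≠ 0`.

Injectivity: if `m(p)` and `m(q)` are positively proportional, linear programming duality through
the `w`'s forces equal supports, and Gibbs' inequality through the `v`'s forces `p = q`.

Surjectivity: for large `β`, maximising `u · θ` over the compact set where the total mass is at most
one gives, by Lagrange multipliers, a Gibbs vector with barycentre in direction `θ`; then `β → ∞`.
-/

open Filter Topology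

namespace CayleyKMS

section General

variable {ι E : Type*} [Fintype ι] [NormedAddCommGroup E] [InnerProductSpace ℝ E]

/-- The probability-vector candidate `(exp (u · c_s - β F(s)))_s`. -/
noncomputable def gibbs (c : ι → E) (F : ι → ℝ) (β : ℝ) (u : E) : ι → ℝ :=
  fun s => Real.exp (inner ℝ u (c s) - β * F s)

/-- The Gibbs vectors of total mass one at parameter `β`. -/
def gibbsSet (c : ι → E) (F : ι → ℝ) (β : ℝ) : Set (ι → ℝ) :=
  {q | ∃ u, ∑ s, gibbs c F β u s = 1 ∧ gibbs c F β u = q}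

/-- The limit set of `gibbsSet c F β` as `β → ∞`. -/
def gibbsLimit (c : ι → E) (F : ι → ℝ) : Set (ι → ℝ) :=
  ⋂ b : ℝ, closure (⋃ β ∈ Set.Ici b, gibbsSet c F β)

/-- The barycentre `∑ p_s c_s`. -/
def moment (c : ι → E) (p : ι → ℝ) : E := ∑ s, p s • c s

theorem continuous_moment (c : ι → E) : Continuous (moment c) := by
  unfold moment; fun_prop

theorem inner_moment (c : ι → E) (p : ι → ℝ) (u : E) :
    inner ℝ u (moment c p) = ∑ s, p s * inner ℝ u (c s) := by
  simp [moment, inner_sum, inner_smul_right]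

theorem gibbsSet_subset_stdSimplex (c : ι → E) (F : ι → ℝ) (β : ℝ) :
    gibbsSet c F β ⊆ stdSimplex ℝ ι := by
  rintro _ ⟨u, hu, rfl⟩
  exact ⟨fun s => (Real.exp_pos _).le, hu⟩

theorem gibbsLimit_subset_stdSimplex (c : ι → E) (F : ι → ℝ) :
    gibbsLimit c F ⊆ stdSimplex ℝ ι := by
  intro p hp
  have h := Set.mem_iInter.1 hp 0
  refine closure_minimal ?_ (isClosed_stdSimplex ℝ ι) h
  exact Set.iUnion₂_subset fun β _ => gibbsSet_subset_stdSimplex c F β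

theorem isCompact_gibbsLimit (c : ι → E) (F : ι → ℝ) : IsCompact (gibbsLimit c F) :=
  (isCompact_stdSimplex ℝ ι).of_isClosed_subset (isClosed_iInter fun _ => isClosed_closure)
    (gibbsLimit_subset_stdSimplex c F)

/-! ### Structure of limit points -/

theorem exists_seq_of_mem_gibbsLimit {c : ι → E} {F : ι → ℝ} {p : ι → ℝ}
    (hp : p ∈ gibbsLimit c F) :
    ∃ (u : ℕ → E) (β : ℕ → ℝ), Tendsto β atTop atTop ∧
      Tendsto (fun k => gibbs c F (β k) (u k)) atTop (𝓝 p) := by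
  have key : ∀ k : ℕ, ∃ (u : E) (β : ℝ), (k : ℝ) ≤ β ∧
      dist (gibbs c F β u) p < 1 / ((k : ℝ) + 1) := by
    intro k
    have h := Metric.mem_closure_iff.1 (Set.mem_iInter.1 hp (k : ℝ)) (1 / ((k : ℝ) + 1))
      (by positivity)
    obtain ⟨q, hq, hd⟩ := h
    simp only [Set.mem_iUnion] at hq
    obtain ⟨β, hβ, u, -, rfl⟩ := hq
    exact ⟨u, β, hβ, by rwa [dist_comm]⟩
  choose u β hβ hd using key
  refine ⟨u, β, tendsto_atTop_mono hβ tendsto_natCast_atTop_atTop, ?_⟩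
  rw [tendsto_iff_dist_tendsto_zero]
  exact squeeze_zero (fun _ => dist_nonneg) (fun k => (hd k).le)
    tendsto_one_div_add_atTop_nhds_zero_nat

/-- Points of the limit set are exponential families on the set of active constraints of a point
`w` of the polyhedron `{w | ∀ s, w · c_s ≤ F(s)}`. -/
theorem exists_exponent_of_mem_gibbsLimit [FiniteDimensional ℝ E] {c : ι → E} {F : ι → ℝ}
    {p : ι → ℝ} (hp : p ∈ gibbsLimit c F) :
    ∃ w v : E, (∀ s, p s ≠ 0 → inner ℝ w (c s) = F s ∧ Real.log (p s) = inner ℝ v (c s)) ∧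
      ∀ s, p s = 0 → inner ℝ w (c s) < F s := by
  classical
  obtain ⟨u, β, hβ, hlim⟩ := exists_seq_of_mem_gibbsLimit hp
  have hlim' := tendsto_pi_nhds.1 hlim
  -- The exponents are linear in the pair `(u, β)`. On the support of `p` they converge to `log
  -- p_s`; off it they tend to `-∞`.
  let ℓ : ι → (E × ℝ) →ₗ[ℝ] ℝ := fun s =>
    (innerₛₗ ℝ (c s)).comp (LinearMap.fst ℝ E ℝ) - F s • LinearMap.snd ℝ E ℝ
  have hℓ : ∀ s x, ℓ s x = inner ℝ x.1 (c s) - x.2 * F s := by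
    intro s x
    simp [ℓ, real_inner_comm, mul_comm]
  let L : (E × ℝ) →ₗ[ℝ] (ι → ℝ) := LinearMap.pi fun s => if p s = 0 then 0 else ℓ s
  have hL : ∀ s, p s ≠ 0 → ∀ x, L x s = ℓ s x := fun s hs x => by simp [L, hs]
  have hlog : ∀ s, p s ≠ 0 → Tendsto (fun k => ℓ s (u k, β k)) atTop (𝓝 (Real.log (p s))) := by
    intro s hs
    have := (hlim' s).log hs
    simpa [gibbs, hℓ] using this
  have hbot : ∀ s, p s = 0 → Tendsto (fun k => ℓ s (u k, β k)) atTop atBot := by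
    intro s hs
    have h := hlim' s
    rw [hs] at h
    simpa [gibbs, hℓ] using h
  have hLlim : Tendsto (fun k => L (u k, β k)) atTop (𝓝 fun s => Real.log (p s)) := by
    refine tendsto_pi_nhds.2 fun s => ?_
    by_cases hs : p s = 0
    · simp [L, hs]
    · simpa only [hL s hs] using hlog s hs
  have hmem : (fun s => Real.log (p s)) ∈ LinearMap.range L :=
    (Submodule.closed_of_finiteDimensional (LinearMap.range L)).mem_of_tendsto hLlim
      (Eventually.of_forall fun k => ⟨_, rfl⟩)
  -- A continuous linear section of `L` gives a convergent correction `y k`. Subtracting it makes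
  -- the exponents on the support vanish exactly, while the others still tend to `-∞` and the
  -- `β`-coordinate to `+∞`.
  obtain ⟨M, hM⟩ := L.rangeRestrict.exists_rightInverse_of_surjective L.range_rangeRestrict
  have hLM : ∀ z : LinearMap.range L, L (M z) = z := fun z => by
    have := LinearMap.congr_fun hM z
    simpa using congrArg Subtype.val this
  have hMc : Continuous M := M.continuous_of_finiteDimensional
  let y : ℕ → E × ℝ := fun k => M (L.rangeRestrict (u k, β k))
  have hy : Tendsto y atTop (𝓝 (M ⟨_, hmem⟩)) :=
    (hMc.tendsto _).comp (tendsto_subtype_rng.2 hLlim)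
  set y₀ := M ⟨_, hmem⟩ with hy₀
  have hy₀s : ∀ s, p s ≠ 0 → ℓ s y₀ = Real.log (p s) := fun s hs => by
    rw [← hL s hs, hy₀, hLM]
  have hys : ∀ s, p s ≠ 0 → ∀ k, ℓ s ((u k, β k) - y k) = 0 := fun s hs k => by
    rw [map_sub, ← hL s hs, ← hL s hs, hLM]; simp
  have hev : ∀ᶠ k in atTop, (∀ s, p s = 0 → ℓ s ((u k, β k) - y k) < 0) ∧
      0 < ((u k, β k) - y k).2 := by
    refine Eventually.and (eventually_all.2 fun s => ?_) ?_
    · by_cases hs : p s = 0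
      · have hc : Continuous (ℓ s) := (ℓ s).continuous_of_finiteDimensional
        have h1 := (hbot s hs).atBot_add ((hc.tendsto _).comp hy).neg
        filter_upwards [h1.eventually_lt_atBot 0] with k hk _
        rw [map_sub, sub_eq_add_neg]; exact hk
      · exact Eventually.of_forall fun k h => absurd h hs
    · have h1 := hβ.atTop_add ((continuous_snd.tendsto _).comp hy).neg
      filter_upwards [h1.eventually_gt_atTop 0] with k hk
      rw [Prod.snd_sub, sub_eq_add_neg]; exact hk
  obtain ⟨k, hk, hpos⟩ := hev.exists
  set x := (u k, β k) - y k with hx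
  have hw : ∀ s, inner ℝ (x.2⁻¹ • x.1) (c s) = F s + x.2⁻¹ * ℓ s x := fun s => by
    rw [hℓ, inner_smul_left]
    simp only [conj_trivial]
    field_simp
    ring
  -- Rescaling `x` to `β`-coordinate one gives `w`. On the support `F(s) = w · c_s`, so `ℓ s y₀ =
  -- (y₀.1 - y₀.2 w) · c_s`, which gives `v`.
  refine ⟨x.2⁻¹ • x.1, y₀.1 - y₀.2 • (x.2⁻¹ • x.1), fun s hs => ?_, fun s hs => ?_⟩
  · have h1 : inner ℝ (x.2⁻¹ • x.1) (c s) = F s := by rw [hw, hys s hs k]; simp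
    refine ⟨h1, ?_⟩
    rw [inner_sub_left, inner_smul_left _ _ y₀.2, h1, ← hy₀s s hs, hℓ]
    simp
  · rw [hw]
    have := mul_neg_of_pos_of_neg (inv_pos.2 hpos) (hk s hs)
    linarith

theorem moment_ne_zero [FiniteDimensional ℝ E] {c : ι → E} {F : ι → ℝ} (hF : ∀ s, 0 < F s)
    {p : ι → ℝ} (hp : p ∈ gibbsLimit c F) : moment c p ≠ 0 := by
  obtain ⟨w, v, h1, -⟩ := exists_exponent_of_mem_gibbsLimit hp
  obtain ⟨hp0, hp1⟩ := gibbsLimit_subset_stdSimplex c F hp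
  intro h0
  have h : ∑ s, p s * F s = 0 := by
    rw [← inner_zero_right (𝕜 := ℝ) w, ← h0, inner_moment]
    refine Finset.sum_congr rfl fun s _ => ?_
    by_cases hs : p s = 0
    · simp [hs]
    · rw [(h1 s hs).1]
  rw [Finset.sum_eq_zero_iff_of_nonneg fun s _ => mul_nonneg (hp0 s) (hF s).le] at h
  have : ∑ s, p s = 0 := Finset.sum_eq_zero fun s hs =>
    (mul_eq_zero.1 (h s hs)).resolve_right (hF s).ne'
  linarith

/-! ### Uniqueness of the limit point in a given direction -/

/-- Gibbs' inequality, for vectors with the same support. -/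
theorem sum_mul_log_le {p q : ι → ℝ} (hp : p ∈ stdSimplex ℝ ι) (hq : q ∈ stdSimplex ℝ ι)
    (hpq : ∀ s, p s = 0 ↔ q s = 0) :
    ∑ s, p s * Real.log (q s) ≤ ∑ s, p s * Real.log (p s) ∧
      (∑ s, p s * Real.log (q s) = ∑ s, p s * Real.log (p s) → p = q) := by
  have hle : ∀ s, p s * Real.log (q s) ≤ p s * Real.log (p s) + (q s - p s) := by
    intro s
    by_cases hs : p s = 0
    · simp [hs, (hpq s).1 hs]
    have hps := lt_of_le_of_ne (hp.1 s) (Ne.symm hs)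
    have hqs := lt_of_le_of_ne (hq.1 s) (Ne.symm fun h => hs ((hpq s).2 h))
    have := Real.log_le_sub_one_of_pos (div_pos hqs hps)
    rw [Real.log_div hqs.ne' hps.ne'] at this
    have h2 := mul_le_mul_of_nonneg_left this hps.le
    have h3 : p s * (q s / p s - 1) = q s - p s := by field_simp
    linarith [mul_sub (p s) (Real.log (q s)) (Real.log (p s))]
  have hsum : ∑ s, (p s * Real.log (p s) + (q s - p s)) = ∑ s, p s * Real.log (p s) := by
    rw [Finset.sum_add_distrib, Finset.sum_sub_distrib, hp.2, hq.2]; simp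
  refine ⟨hsum ▸ Finset.sum_le_sum fun s _ => hle s, fun heq => ?_⟩
  rw [← hsum, Finset.sum_eq_sum_iff_of_le fun s _ => hle s] at heq
  funext s
  by_cases hs : p s = 0
  · rw [hs, (hpq s).1 hs]
  have hps := lt_of_le_of_ne (hp.1 s) (Ne.symm hs)
  have hqs := lt_of_le_of_ne (hq.1 s) (Ne.symm fun h => hs ((hpq s).2 h))
  by_contra hne
  have := Real.log_lt_sub_one_of_pos (div_pos hqs hps)
    fun h => hne ((div_eq_one_iff_eq hps.ne').1 h).symm
  rw [Real.log_div hqs.ne' hps.ne'] at this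
  have h2 := mul_lt_mul_of_pos_left this hps
  have h3 : p s * (q s / p s - 1) = q s - p s := by field_simp
  linarith [mul_sub (p s) (Real.log (q s)) (Real.log (p s)), heq s (Finset.mem_univ s)]

/-- One half of the comparison of supports: complementary slackness. -/
theorem sum_mul_le_of_moment_eq {c : ι → E} {F : ι → ℝ} {p q : ι → ℝ} {t : ℝ} {w : E}
    (ht : 0 < t) (hq : ∀ s, 0 ≤ q s) (hpq : moment c p = t • moment c q)
    (hw : ∀ s, p s ≠ 0 → inner ℝ w (c s) = F s) (hw' : ∀ s, p s = 0 → inner ℝ w (c s) < F s) :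
    ∑ s, p s * F s ≤ t * ∑ s, q s * F s ∧
      (∑ s, p s * F s = t * ∑ s, q s * F s → ∀ s, p s = 0 → q s = 0) := by
  have h1 : ∑ s, p s * F s = t * ∑ s, q s * inner ℝ w (c s) := by
    rw [← inner_moment, ← inner_smul_right, ← hpq, inner_moment]
    refine Finset.sum_congr rfl fun s _ => ?_
    by_cases hs : p s = 0
    · simp [hs]
    · rw [hw s hs]
  have hle : ∀ s, q s * inner ℝ w (c s) ≤ q s * F s := fun s =>
    mul_le_mul_of_nonneg_left
      (by by_cases hs : p s = 0; exacts [(hw' s hs).le, (hw s hs).le]) (hq s)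
  rw [h1]
  refine ⟨mul_le_mul_of_nonneg_left (Finset.sum_le_sum fun s _ => hle s) ht.le, fun h s hs => ?_⟩
  have h2 := mul_left_cancel₀ ht.ne' h
  rw [Finset.sum_eq_sum_iff_of_le fun s _ => hle s] at h2
  by_contra hqs
  exact (hw' s hs).ne (mul_left_cancel₀ hqs (h2 s (Finset.mem_univ s)))

theorem eq_of_moment_eq_smul [FiniteDimensional ℝ E] {c : ι → E} {F : ι → ℝ} {p q : ι → ℝ}
    (hp : p ∈ gibbsLimit c F) (hq : q ∈ gibbsLimit c F) {t : ℝ} (ht : 0 < t)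
    (hpq : moment c p = t • moment c q) : p = q := by
  obtain ⟨w, v, h1, h2⟩ := exists_exponent_of_mem_gibbsLimit hp
  obtain ⟨w', v', h1', h2'⟩ := exists_exponent_of_mem_gibbsLimit hq
  have hps := gibbsLimit_subset_stdSimplex c F hp
  have hqs := gibbsLimit_subset_stdSimplex c F hq
  have hqp : moment c q = t⁻¹ • moment c p := by rw [hpq, inv_smul_smul₀ ht.ne']
  obtain ⟨a1, b1⟩ := sum_mul_le_of_moment_eq ht hqs.1 hpq (fun s hs => (h1 s hs).1) h2
  obtain ⟨a2, b2⟩ := sum_mul_le_of_moment_eq (inv_pos.2 ht) hps.1 hqp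
    (fun s hs => (h1' s hs).1) h2'
  have heq : ∑ s, p s * F s = t * ∑ s, q s * F s := by
    refine le_antisymm a1 ?_
    have := mul_le_mul_of_nonneg_left a2 ht.le
    rwa [mul_inv_cancel_left₀ ht.ne'] at this
  have hsupp : ∀ s, p s = 0 ↔ q s = 0 := fun s =>
    ⟨b1 heq s, b2 (by rw [heq, inv_mul_cancel_left₀ ht.ne']) s⟩
  have hv : ∀ (x y : ι → ℝ) (v : E), (∀ s, y s = 0 → x s = 0) →
      (∀ s, y s ≠ 0 → Real.log (y s) = inner ℝ v (c s)) →
      ∑ s, x s * Real.log (y s) = inner ℝ v (moment c x) := by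
    intro x y v hxy hy
    rw [inner_moment]
    refine Finset.sum_congr rfl fun s _ => ?_
    by_cases hs : y s = 0
    · simp [hxy s hs]
    · rw [hy s hs]
  have e1 := hv p p v (fun _ h => h) fun s hs => (h1 s hs).2
  have e2 := hv q p v (fun s => (hsupp s).1) fun s hs => (h1 s hs).2
  have e3 := hv p q v' (fun s => (hsupp s).2) fun s hs => (h1' s hs).2
  have e4 := hv q q v' (fun _ h => h) fun s hs => (h1' s hs).2
  -- Now `∑ p log p = t ∑ q log p` and `∑ p log q = t ∑ q log q`, so Gibbs' inequality for `(q, p)`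
  -- gives the reverse of the one for `(p, q)`.
  rw [hpq, inner_smul_right, ← e2] at e1
  rw [hpq, inner_smul_right, ← e4] at e3
  obtain ⟨g1, g1'⟩ := sum_mul_log_le hps hqs hsupp
  obtain ⟨g2, -⟩ := sum_mul_log_le hqs hps fun s => (hsupp s).symm
  refine g1' (le_antisymm g1 ?_)
  rw [e1, e3]
  exact mul_le_mul_of_nonneg_left g2 ht.le

/-! ### Existence of a limit point in every direction -/

theorem continuous_sum_gibbs (c : ι → E) (F : ι → ℝ) (β : ℝ) :
    Continuous fun u => ∑ s, gibbs c F β u s := by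
  unfold gibbs; fun_prop

/-- Mass at most one forces `u · c_s ≤ β F(s)` for every `s`. The sum of the positive parts of `u ·
c_s` is positively homogeneous and positive on the unit sphere, hence at least `δ‖u‖`. -/
theorem isBounded_sublevel [FiniteDimensional ℝ E] {c : ι → E}
    (hc : ∀ u : E, u ≠ 0 → ∃ s, 0 < inner ℝ u (c s)) (F : ι → ℝ) (β : ℝ) :
    Bornology.IsBounded {u | ∑ s, gibbs c F β u s ≤ 1} := by
  let g : E → ℝ := fun u => ∑ s, max (inner ℝ u (c s)) 0
  have hg : Continuous g := by fun_prop
  obtain ⟨δ, hδ, hmin⟩ := (isCompact_sphere (0 : E) 1).exists_forall_le' (a := 0)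
    hg.continuousOn fun u hu => by
      obtain ⟨s, hs⟩ := hc u (ne_zero_of_mem_unit_sphere ⟨u, hu⟩)
      exact Finset.sum_pos' (fun _ _ => le_max_right _ _) ⟨s, Finset.mem_univ s, lt_max_of_lt_left hs⟩
  refine isBounded_iff_forall_norm_le.2 ⟨(∑ s, max (β * F s) 0) / δ, fun u hu => ?_⟩
  rw [le_div_iff₀ hδ]
  have hle : g u ≤ ∑ s, max (β * F s) 0 := by
    refine Finset.sum_le_sum fun s _ => max_le_max_right _ ?_
    have h1 : gibbs c F β u s ≤ 1 :=
      (Finset.single_le_sum (f := gibbs c F β u) (fun s _ => (Real.exp_pos _).le)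
        (Finset.mem_univ s)).trans hu
    have := Real.exp_le_one_iff.1 h1
    linarith
  refine le_trans ?_ hle
  by_cases h0 : u = 0
  · rw [h0, norm_zero, zero_mul]
    exact Finset.sum_nonneg fun s _ => le_max_right _ _
  have hn : 0 < ‖u‖ := norm_pos_iff.2 h0
  have h1 := hmin (‖u‖⁻¹ • u) (by simp [norm_smul, hn.ne'])
  have h2 : g u = ‖u‖ * g (‖u‖⁻¹ • u) := by
    simp only [g, Finset.mul_sum]
    refine Finset.sum_congr rfl fun s _ => ?_
    rw [mul_max_of_nonneg _ _ hn.le, inner_smul_left]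
    simp [hn.ne']
  rw [h2]
  exact mul_le_mul_of_nonneg_left h1 hn.le

theorem hasDerivAt_sum_gibbs (c : ι → E) (F : ι → ℝ) (β : ℝ) (u d : E) :
    HasDerivAt (fun t : ℝ => ∑ s, gibbs c F β (u + t • d) s)
      (inner ℝ d (moment c (gibbs c F β u))) 0 := by
  rw [inner_moment]
  refine HasDerivAt.fun_sum fun s _ => ?_
  have h : HasDerivAt (fun t : ℝ => inner ℝ u (c s) + t * inner ℝ d (c s) - β * F s)
      (inner ℝ d (c s)) 0 := by
    simpa using (((hasDerivAt_id (0 : ℝ)).mul_const (inner ℝ d (c s))).const_add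
      (inner ℝ u (c s))).sub_const (β * F s)
  have h2 := h.exp
  simp only [gibbs, inner_add_left, inner_smul_left, conj_trivial]
  simpa using h2

/-- A vector in the closed half space of every direction positive on `θ` is a nonnegative multiple
of `θ`. -/
theorem eq_smul_of_forall_inner_pos {θ m : E} (hθ : θ ≠ 0)
    (h : ∀ d : E, 0 < inner ℝ d θ → 0 ≤ inner ℝ d m) : ∃ t : ℝ, 0 ≤ t ∧ m = t • θ := by
  have hθ2 : 0 < inner ℝ θ θ := real_inner_self_pos.2 hθ
  set t : ℝ := inner ℝ θ m / inner ℝ θ θ with ht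
  have ht0 : 0 ≤ t := div_nonneg (h θ hθ2) hθ2.le
  refine ⟨t, ht0, ?_⟩
  have hd : inner ℝ (t • θ - m) θ = 0 := by
    rw [inner_sub_left, inner_smul_left, real_inner_comm θ m, ht]
    simp only [conj_trivial]
    field_simp; ring
  -- The residual `t • θ - m` is orthogonal to `θ`, so `h` applies only after adding `ε • θ`; let `ε
  -- → 0`.
  have hlim : Tendsto (fun ε : ℝ => inner ℝ (t • θ - m + ε • θ) m) (𝓝[>] 0)
      (𝓝 (inner ℝ (t • θ - m + (0 : ℝ) • θ) m)) :=
    (Continuous.tendsto (by fun_prop) 0).mono_left nhdsWithin_le_nhds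
  have h0 : 0 ≤ inner ℝ (t • θ - m + (0 : ℝ) • θ) m := by
    refine ge_of_tendsto hlim ?_
    filter_upwards [self_mem_nhdsWithin] with ε hε
    refine h _ ?_
    rw [inner_add_left, hd, inner_smul_left, zero_add]
    exact mul_pos hε hθ2
  rw [zero_smul, add_zero] at h0
  have h1 : inner ℝ (t • θ - m) (t • θ - m) ≤ 0 := by
    rw [inner_sub_right, inner_smul_right, hd]; linarith
  have := real_inner_self_nonpos.1 h1
  exact (sub_eq_zero.1 this).symm

theorem exists_gibbs_moment_eq_smul [FiniteDimensional ℝ E] {c : ι → E}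
    (hc : ∀ u : E, u ≠ 0 → ∃ s, 0 < inner ℝ u (c s)) {F : ι → ℝ} {β : ℝ}
    (hβ : ∑ s, gibbs c F β 0 s < 1) {θ : E} (hθ : θ ≠ 0) :
    ∃ q ∈ gibbsSet c F β, ∃ t : ℝ, 0 ≤ t ∧ moment c q = t • θ := by
  set f : E → ℝ := fun u => ∑ s, gibbs c F β u s with hf
  have hfc : Continuous f := continuous_sum_gibbs c F β
  have hK : IsCompact {u | f u ≤ 1} :=
    Metric.isCompact_of_isClosed_isBounded (isClosed_le hfc continuous_const)
      (isBounded_sublevel hc F β)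
  obtain ⟨u, hu, hmax⟩ := hK.exists_isMaxOn ⟨0, hβ.le⟩
    (f := fun u => inner ℝ u θ) (by fun_prop)
  -- By maximality, any move with `d · θ > 0` leaves the sublevel set. Hence the mass at `u` is
  -- exactly one and its derivative along `d`, namely `d · m`, is nonnegative.
  have hout : ∀ d : E, 0 < inner ℝ d θ → ∀ ε : ℝ, 0 < ε → 1 < f (u + ε • d) := by
    intro d hd ε hε
    by_contra! hle
    have := hmax (show u + ε • d ∈ {u | f u ≤ 1} from hle)
    simp only [Set.mem_ofPred_eq, inner_add_left, inner_smul_left, conj_trivial] at this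
    linarith [mul_pos hε hd]
  have hu1 : f u = 1 := by
    refine le_antisymm hu ?_
    have hlim : Tendsto (fun ε : ℝ => f (u + ε • θ)) (𝓝[>] 0) (𝓝 (f (u + (0 : ℝ) • θ))) :=
      (Continuous.tendsto (by fun_prop) 0).mono_left nhdsWithin_le_nhds
    rw [zero_smul, add_zero] at hlim
    refine ge_of_tendsto hlim ?_
    filter_upwards [self_mem_nhdsWithin] with ε hε
    exact (hout θ (real_inner_self_pos.2 hθ) ε hε).le
  refine ⟨_, ⟨u, hu1, rfl⟩, eq_smul_of_forall_inner_pos hθ fun d hd => ?_⟩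
  have hder := (hasDerivAt_iff_tendsto_slope.1 (hasDerivAt_sum_gibbs c F β u d)).mono_left
    (nhdsWithin_mono (0 : ℝ) (fun x (hx : 0 < x) => hx.ne') : 𝓝[>] (0 : ℝ) ≤ 𝓝[≠] 0)
  refine ge_of_tendsto hder ?_
  filter_upwards [self_mem_nhdsWithin] with ε hε
  have h1 := hout d hd ε hε
  rw [slope_def_field, sub_zero, zero_smul, add_zero]
  refine div_nonneg (sub_nonneg.2 ?_) (le_of_lt hε)
  change f u ≤ f (u + ε • d)
  rw [hu1]; exact h1.le

theorem eventually_sum_gibbs_zero_lt_one (c : ι → E) {F : ι → ℝ} (hF : ∀ s, 0 < F s) :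
    ∀ᶠ β in atTop, ∑ s, gibbs c F β 0 s < 1 := by
  have h : Tendsto (fun β => ∑ s, gibbs c F β 0 s) atTop (𝓝 (∑ _s : ι, (0 : ℝ))) := by
    refine tendsto_finsetSum _ fun s _ => ?_
    simp only [gibbs, inner_zero_left, zero_sub]
    exact Real.tendsto_exp_neg_atTop_nhds_zero.comp (tendsto_id.atTop_mul_const (hF s))
  rw [Finset.sum_const_zero] at h
  exact h.eventually_lt_const one_pos

theorem exists_mem_gibbsLimit_moment_eq_smul [FiniteDimensional ℝ E] {c : ι → E}
    (hc : ∀ u : E, u ≠ 0 → ∃ s, 0 < inner ℝ u (c s)) {F : ι → ℝ} (hF : ∀ s, 0 < F s)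
    {θ : E} (hθ : ‖θ‖ = 1) :
    ∃ p ∈ gibbsLimit c F, ∃ t : ℝ, 0 ≤ t ∧ moment c p = t • θ := by
  have hθ0 : θ ≠ 0 := norm_ne_zero_iff.1 (by rw [hθ]; exact one_ne_zero)
  obtain ⟨b, hb⟩ := eventually_atTop.1 (eventually_sum_gibbs_zero_lt_one c hF)
  have key : ∀ k : ℕ, ∃ q ∈ gibbsSet c F (max b k), ∃ t : ℝ, 0 ≤ t ∧ moment c q = t • θ :=
    fun k => exists_gibbs_moment_eq_smul hc (hb _ (le_max_left _ _)) hθ0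
  choose q hq t ht hqt using key
  obtain ⟨p, -, φ, hφ, hlim⟩ := (isCompact_stdSimplex ℝ ι).tendsto_subseq
    fun k => gibbsSet_subset_stdSimplex c F _ (hq k)
  refine ⟨p, Set.mem_iInter.2 fun B => mem_closure_of_tendsto hlim ?_, inner ℝ θ (moment c p), ?_⟩
  · filter_upwards [hφ.tendsto_atTop.eventually (eventually_ge_atTop ⌈B⌉₊)] with k hk
    refine Set.mem_iUnion₂.2 ⟨max b (φ k : ℝ), ?_, hq (φ k)⟩
    exact (Nat.ceil_le.1 hk).trans (le_max_right _ _)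
  -- As `θ` is a unit vector, each `t k` is the inner product of `θ` with the barycentre, so these
  -- coefficients converge along the subsequence.
  have hm := ((continuous_moment c).tendsto p).comp hlim
  have hi : ∀ k, inner ℝ θ (moment c (q k)) = t k := fun k => by
    rw [hqt, inner_smul_right, real_inner_self_eq_norm_sq, hθ]; simp
  have him : Tendsto (fun k => inner ℝ θ (moment c (q (φ k)))) atTop
      (𝓝 (inner ℝ θ (moment c p))) := tendsto_const_nhds.inner hm
  refine ⟨ge_of_tendsto' him fun k => (ht _).trans_eq (hi _).symm, ?_⟩
  refine tendsto_nhds_unique hm ((him.smul_const θ).congr fun k => ?_)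
  rw [hi, ← hqt]; rfl

theorem nonempty_gibbsLimit_homeomorph_sphere [FiniteDimensional ℝ E] {c : ι → E}
    (hc : ∀ u : E, u ≠ 0 → ∃ s, 0 < inner ℝ u (c s)) {F : ι → ℝ} (hF : ∀ s, 0 < F s) :
    Nonempty (gibbsLimit c F ≃ₜ Metric.sphere (0 : E) 1) := by
  have hne : ∀ p : gibbsLimit c F, ‖moment c (p : ι → ℝ)‖ ≠ 0 := fun p =>
    norm_ne_zero_iff.2 (moment_ne_zero hF p.2)
  let Φ : gibbsLimit c F → Metric.sphere (0 : E) 1 := fun p =>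
    ⟨‖moment c (p : ι → ℝ)‖⁻¹ • moment c (p : ι → ℝ), by simp [norm_smul, hne p]⟩
  have hm : Continuous fun p : gibbsLimit c F => moment c (p : ι → ℝ) :=
    (continuous_moment c).comp continuous_subtype_val
  have hΦ : Continuous Φ := ((hm.norm.inv₀ hne).smul hm).subtype_mk _
  have hbij : Function.Bijective Φ := by
    constructor
    · intro p q hpq
      have h : ‖moment c (p : ι → ℝ)‖⁻¹ • moment c (p : ι → ℝ) =
        ‖moment c (q : ι → ℝ)‖⁻¹ • moment c (q : ι → ℝ) := congrArg Subtype.val hpq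
      refine Subtype.ext (eq_of_moment_eq_smul p.2 q.2
        (t := ‖moment c (p : ι → ℝ)‖ * ‖moment c (q : ι → ℝ)‖⁻¹) ?_ ?_)
      · exact mul_pos (norm_pos_iff.2 (moment_ne_zero hF p.2))
          (inv_pos.2 (norm_pos_iff.2 (moment_ne_zero hF q.2)))
      · rw [mul_smul, ← h, smul_inv_smul₀ (hne p)]
    · rintro ⟨θ, hθ⟩
      have hθ1 : ‖θ‖ = 1 := by simpa using hθ
      obtain ⟨p, hp, t, ht, hpt⟩ := exists_mem_gibbsLimit_moment_eq_smul hc hF hθ1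
      refine ⟨⟨p, hp⟩, Subtype.ext ?_⟩
      have ht0 : t ≠ 0 := fun h => moment_ne_zero hF hp (by rw [hpt, h, zero_smul])
      change ‖moment c p‖⁻¹ • moment c p = θ
      rw [hpt, norm_smul, hθ1, mul_one, Real.norm_of_nonneg ht, inv_smul_smul₀ ht0]
  have := isCompact_iff_compactSpace.1 (isCompact_gibbsLimit c F)
  exact ⟨hΦ.homeoOfEquivCompactToT2 (f := Equiv.ofBijective Φ hbij)⟩

end General

/-! ### Application to the group -/

theorem NInfty_eq_gibbsLimit {G : Type*} [Group G] {n : ℕ} (Y : Finset G) (F : Y → ℝ)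
    (c' : Fin n → (Additive G →+ ℝ)) :
    NInfty Y F c' = gibbsLimit (fun s : Y => cVec c' (s : G)) F := by
  unfold NInfty gibbsLimit
  congr! 6 with b β hβ
  ext q
  simp only [NBeta, Q, gibbsSet, gibbs, Set.mem_image, Set.mem_ofPred_eq]
  refine exists_congr fun u => and_congr_right fun _ => Eq.congr_left (funext fun s => ?_)
  rw [← Real.exp_add, gibbs]
  ring_nf

theorem inner_cVec {G : Type*} [Group G] {n : ℕ} (c' : Fin n → (Additive G →+ ℝ))
    (u : EuclideanSpace ℝ (Fin n)) (g : G) :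
    inner ℝ u (cVec c' g) = (∑ i, u i • c' i) (Additive.ofMul g) := by
  simp [cVec, PiLp.inner_apply, mul_comm]

/-- If `Y` generates `G` as a semigroup, the vectors `c_s` positively span `ℝⁿ`. -/
theorem exists_inner_cVec_pos {G : Type*} [Group G] {n : ℕ} {Y : Finset G}
    (hY : Subsemigroup.closure (Y : Set G) = ⊤) {c' : Fin n → (Additive G →+ ℝ)}
    (hc' : LinearIndependent ℝ c') (u : EuclideanSpace ℝ (Fin n)) (hu : u ≠ 0) :
    ∃ s : Y, 0 < inner ℝ u (cVec c' (s : G)) := by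
  set ψ : Additive G →+ ℝ := ∑ i, u i • c' i with hψ
  simp only [inner_cVec, ← hψ]
  by_contra! hle
  have hall : ∀ g : G, ψ (Additive.ofMul g) ≤ 0 := by
    intro g
    have hg : g ∈ Subsemigroup.closure (Y : Set G) := hY ▸ Subsemigroup.mem_top g
    induction hg using Subsemigroup.closure_induction with
    | mem x hx => exact hle ⟨x, hx⟩
    | mul x y _ _ hx hy => rw [ofMul_mul, map_add]; exact add_nonpos hx hy
  -- A homomorphism to `ℝ` that is nonpositive on the whole group vanishes, by evaluating it at
  -- inverses.
  have hzero : ψ = 0 := by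
    refine AddMonoidHom.ext fun g => le_antisymm (hall g.toMul) ?_
    have := hall (g.toMul)⁻¹
    rw [ofMul_inv, map_neg] at this
    simpa using this
  have := Fintype.linearIndependent_iff.1 hc' u hzero
  exact hu (by ext i; exact this i)

end CayleyKMS

theorem mainTheorem2 {G : Type*} [Group G] (Y : Finset G) (hYcard : 2 ≤ Y.card)
    (hYgen : Subsemigroup.closure (Y : Set G) = ⊤)
    (F : Y → ℝ) (hF : ∀ s, 0 < F s)
    (n : ℕ) (hn : 1 ≤ n)
    (hrank : Module.finrank ℤ (Additive (Abelianization G)) = n)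
    (c' : Fin n → (Additive G →+ ℝ)) (hc' : LinearIndependent ℝ c') :
    CayleyKMS.NInfty Y F c' ⊆ stdSimplex ℝ Y ∧
      Nonempty (CayleyKMS.NInfty Y F c' ≃ₜ
        Metric.sphere (0 : EuclideanSpace ℝ (Fin n)) 1) := by
  rw [CayleyKMS.NInfty_eq_gibbsLimit]
  exact ⟨CayleyKMS.gibbsLimit_subset_stdSimplex _ F,
    CayleyKMS.nonempty_gibbsLimit_homeomorph_sphere
      (CayleyKMS.exists_inner_cVec_pos hYgen hc') hF⟩
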